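/- A user buffers $D\ge 0$ packets of a file of size $F\in[0,\infty]$ and then plays it at unit rate. Packets arrive from a free server according to a Poisson process $N$ of rate $R_0>0$ and from a costly server according to an independent Poisson process $N^c$ of rate $R_c>0$; put $R_1=R_0+R_c$. A (deterministic) control policy $\pi$ maps, at every time $t$, the history of the buffer sizes up to $t$ and of the actions before $t$ to an action $u_t\in\{0,1\}$ (free server only, or both servers), where a packet arriving exactly at time $t$ is not yet visible when $u_t$ is chosen, in such a way that the resulting buffer equation $$x_t=D+N_t+\int_0^t u_\tau\,dN^c_\tau-t$$ almost surely has exactly one solution $(x,u)$, and $u$ is jointly measurable; $\Pi$ is the set of these policies. Let $\tau_e=\inf\{t:x_t\le 0\}$ and $\tau_f=\inf\{t:x_t\ge F-t\}$. The policy is $(D,\epsilon)$-feasible if $\mathbb P(\tau_e<\tau_f)\le\epsilon$, where $\epsilon>0$. Its cost $J^\pi(D,\epsilon)\in[0,\infty]$ is $\mathbb E\big[\int_0^F u_t\,dt\big]$ if it is $(D,\epsilon)$-feasible, and $\infty$ otherwise. For $R>1$ let $\bar r(R)=\sup\{r\in\mathbb R: r+R(e^{-r}-1)=0\}$. (a)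 If $R_0>1$ and $D\ge\frac{1}{\bar r(R_0)}\log\frac1\epsilon$, then for every file size $F\in[0,\infty]$ one has $\min_{\pi\in\Pi}J^\pi(D,\epsilon)=0$; moreover, the policy $\pi\equiv 0$ that only uses the free server is $(D,\epsilon)$-feasible and has cost $0$. (b) If $R_1>1$, $F=\infty$ and $D<\frac{1}{\bar r(R_1)}\log\frac1\epsilon$, then no policy in $\Pi$ is $(D,\epsilon)$-feasible, and $\min_{\pi\in\Pi}J^\pi(D,\epsilon)=\infty$. -/

import Mathlib

open MeasureTheory ProbabilityTheory Set
open scoped NNReal ENNReal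

noncomputable section

namespace MediaStreaming

/-- A (homogeneous) Poisson process of rate `r`, given by its counting process `N t`, the number of
arrivals in `(0, t]`: it starts at `0`, has nondecreasing right-continuous paths, independent
increments, and `N t - N s` has the Poisson law with mean `r * (t - s)`. -/
structure IsPoissonProcess {Ω : Type*} [MeasurableSpace Ω] (N : ℝ≥0 → Ω → ℕ) (r : ℝ≥0)
    (μ : Measure Ω) : Prop where
  measurable : ∀ t, Measurable (N t)
  start : ∀ᵐ ω ∂μ, N 0 ω = 0
  mono : ∀ᵐ ω ∂μ, Monotone fun t => N t ω
  right_cont : ∀ᵐ ω ∂μ, ∀ t, ContinuousWithinAt (fun s => N s ω) (Ici t) t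
  indep : HasIndepIncrements N μ
  law : ∀ s t, s ≤ t → HasLaw (fun ω => N t ω - N s ω) (poissonMeasure (r * (t - s))) μ

/-- An association rule `π`: at every time `t` it maps the history, that is the buffer sizes on
`[0, t]` and the actions on `[0, t)`, to an action. The action `false` is `0` (only the free server
is used), the action `true` is `1` (both servers are used). -/
abbrev AssociationRule : Type :=
  (t : ℝ≥0) → (Iic t → ℝ) → (Iio t → Bool) → Bool

/-- The rule `π₀ ≡ 0` that only ever uses the free server. -/
def freeOnly : AssociationRule := fun _ _ _ => false

/-- The buffer sizes on `[0, t]` as they are known when the action at time `t` is chosen: a packet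
that may arrive at the very instant `t` has not been seen yet, so the last value is `x (t-)`. -/
def observed (x : ℝ≥0 → ℝ) (t : ℝ≥0) : Iic t → ℝ :=
  fun s => if (s : ℝ≥0) < t then x s else Function.leftLim x t

/-- The pathwise integral `∫_0^t u dc` against a counting path `c`: the sum over the times
`s ∈ (0, t]` of `u s` times the jump of `c` at `s`. -/
def costlyArrivals (c : ℝ≥0 → ℕ) (u : ℝ≥0 → Bool) (t : ℝ≥0) : ℝ :=
  ∑ᶠ s ∈ Ioc (0 : ℝ≥0) t,
    if u s = true then (c s : ℝ) - Function.leftLim (fun r => (c r : ℝ)) s else 0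

/-- The buffer path `x` and the action path `u` solve the closed loop of the rule `π` for the
initial buffer size `D`, the arrival path `n` of the free server and the arrival path `c` of the
costly server. -/
structure IsTrajectory (π : AssociationRule) (D : ℝ) (n c : ℝ≥0 → ℕ)
    (x : ℝ≥0 → ℝ) (u : ℝ≥0 → Bool) : Prop where
  buffer : ∀ t, x t = D + n t + costlyArrivals c u t - t
  action : ∀ t, u t = π t (observed x t) (fun s => u s)

/-- A control policy for the initial buffer size `D` and the arrival processes `N` (free server) and
`Nc` (costly server): an association rule `rule` whose closed loop has almost surely exactly one
solution, together with the buffer process `x` and the action process `u` that it so determines. -/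
structure ControlPolicy {Ω : Type*} [MeasurableSpace Ω] (N Nc : ℝ≥0 → Ω → ℕ) (μ : Measure Ω)
    (D : ℝ) where
  rule : AssociationRule
  x : ℝ≥0 → Ω → ℝ
  u : ℝ≥0 → Ω → Bool
  measurable_x : ∀ t, Measurable (x t)
  measurable_u : Measurable fun p : ℝ≥0 × Ω => u p.1 p.2
  trajectory : ∀ᵐ ω ∂μ, IsTrajectory rule D (fun t => N t ω) (fun t => Nc t ω)
    (fun t => x t ω) (fun t => u t ω)
  unique : ∀ᵐ ω ∂μ, ∀ (x' : ℝ≥0 → ℝ) (u' : ℝ≥0 → Bool),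
    IsTrajectory rule D (fun t => N t ω) (fun t => Nc t ω) x' u' →
      x' = (fun t => x t ω) ∧ u' = (fun t => u t ω)

/-- `τ_e = inf {t : x_t ≤ 0}` (which is `∞` for the empty set). -/
def emptyTime (x : ℝ≥0 → ℝ) : ℝ≥0∞ := ⨅ (t : ℝ≥0) (_ : x t ≤ 0), (t : ℝ≥0∞)

/-- `τ_f = inf {t : x_t ≥ F - t}` for the file size `F ∈ [0, ∞]` (which is `∞` for the empty set,
in particular if `F = ∞`). -/
def finishTime (F : ℝ≥0∞) (x : ℝ≥0 → ℝ) : ℝ≥0∞ :=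
  ⨅ (t : ℝ≥0) (_ : F ≤ ENNReal.ofReal (x t + t)), (t : ℝ≥0∞)

namespace ControlPolicy

variable {Ω : Type*} [MeasurableSpace Ω] {N Nc : ℝ≥0 → Ω → ℕ} {μ : Measure Ω} {D : ℝ}

/-- The interruption probability `p^π(D) = P(τ_e < τ_f)` for the file size `F`. -/
def interruptionProb (P : ControlPolicy N Nc μ D) (F : ℝ≥0∞) : ℝ≥0∞ :=
  μ {ω | emptyTime (fun t => P.x t ω) < finishTime F (fun t => P.x t ω)}

/-- The policy is `(D, ε)`-feasible: `p^π(D) ≤ ε`. -/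
def Feasible (P : ControlPolicy N Nc μ D) (F : ℝ≥0∞) (ε : ℝ) : Prop :=
  P.interruptionProb F ≤ ENNReal.ofReal ε

open Classical in
/-- The cost `J^π(D, ε)`: it is `E[∫_0^F u_t dt]` if the policy is feasible, and `∞` if not. -/
def cost (P : ControlPolicy N Nc μ D) (F : ℝ≥0∞) (ε : ℝ) : ℝ≥0∞ :=
  if P.Feasible F ε then
    ∫⁻ ω, ∫⁻ t in {t : ℝ | 0 ≤ t ∧ ENNReal.ofReal t ≤ F},
      (if P.u t.toNNReal ω = true then 1 else 0) ∂volume ∂μ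
  else ∞

end ControlPolicy

/-- `r̄(R) = sup {r : r + R (e^{-r} - 1) = 0}`, the largest root. -/
def rBar (R : ℝ) : ℝ := sSup {r : ℝ | r + R * (Real.exp (-r) - 1) = 0}

end MediaStreaming

end

namespace MediaStreaming

open Filter Topology

/-! ### The root `rBar` -/

/-! Sample the surplus of arrivals of total rate `R` over playback on a grid of mesh `δ`: it is a
walk with Poisson steps of mean `R δ` and drift `-δ`. Since the step factor has mean `exp (δ (r + R
(e^{-r} - 1)))`, the process `exp (-r * walk)` is a martingale when `r = rBar R`, and stopping it at
the exit from a half-line estimates the ruin probability from both sides.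

Upper bound, for (a): if the buffer fed by the free server alone empties, the walk falls to level
`δ`, which has probability at most `exp (-r (D - δ))` (`measure_exists_walk_le`); let `δ → 0`. Any
interruption, for any file size, needs such an emptying.

Lower bound, for (b): no policy receives more than all packets of both servers, so wherever the walk
of the summed processes is at most `0`, so is the buffer. This has probability at least `exp (-r (D
+ δ))` (`le_measure_exists_walk`), which exceeds `ε` for small `δ`. For `F = ∞` every emptying is an
interruption. -/

theorem rBar_spec {R : ℝ} (hR : 1 < R) :
    0 < rBar R ∧ rBar R + R * (Real.exp (-rBar R) - 1) = 0 := by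
  set S : Set ℝ := {r : ℝ | r + R * (Real.exp (-r) - 1) = 0}
  have hcont : Continuous fun r : ℝ => r + R * (Real.exp (-r) - 1) := by fun_prop
  have hclosed : IsClosed S := isClosed_eq hcont continuous_const
  have hbdd : BddAbove S := ⟨R, fun r hr => by
    have h1 : r + R * (Real.exp (-r) - 1) = 0 := hr
    nlinarith [Real.exp_pos (-r)]⟩
  have hlog : 0 < Real.log R := Real.log_pos hR
  have hlogR : Real.log R + 1 < R := by
    have := Real.add_one_lt_exp hlog.ne'
    rwa [Real.exp_log (by linarith)] at this
  -- Since `0` is itself a root, the interval must avoid it. Its left end `log R > 0` minimises the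
  -- convex function, with value `log R + 1 - R < 0`; at `R` the value is `R e^{-R} > 0`.
  have hmem : (0 : ℝ) ∈ Icc (Real.log R + R * (Real.exp (-Real.log R) - 1))
      (R + R * (Real.exp (-R) - 1)) := by
    constructor
    · rw [Real.exp_neg, Real.exp_log (by linarith), mul_sub, mul_inv_cancel₀ (by linarith)]
      linarith
    · nlinarith [Real.exp_pos (-R)]
  obtain ⟨s, hs, hs0⟩ := intermediate_value_Icc (by linarith) hcont.continuousOn hmem
  have hsS : s ∈ S := hs0
  exact ⟨hlog.trans_le (hs.1.trans (le_csSup hbdd hsS)), hclosed.csSup_mem ⟨s, hsS⟩ hbdd⟩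

/-- With `y = e^{-r/2}` the root equation gives `r = R (1 - y²)`, so the left side is `-R (1 - y)² /
2`. This makes the exponential moment at `r / 2` decay geometrically. -/
theorem half_root_neg {R r : ℝ} (hR : 0 < R) (hr : 0 < r)
    (h : r + R * (Real.exp (-r) - 1) = 0) :
    r / 2 + R * (Real.exp (-(r / 2)) - 1) < 0 := by
  have h1 : Real.exp (-r) = Real.exp (-(r / 2)) ^ 2 := by
    rw [← Real.exp_nat_mul]; congr 1; push_cast; ring
  have h2 : Real.exp (-(r / 2)) < 1 := Real.exp_lt_one_iff.2 (by linarith)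
  rw [h1] at h
  nlinarith [mul_pos hR (pow_pos (sub_pos.2 h2) 2)]

/-! ### Random walks with Poisson increments -/

theorem lintegral_exp_poissonMeasure (l : ℝ≥0) (θ : ℝ) :
    ∫⁻ k, ENNReal.ofReal (Real.exp (-θ * k)) ∂(poissonMeasure l)
      = ENNReal.ofReal (Real.exp (l * (Real.exp (-θ) - 1))) := by
  have hs : HasSum (fun n : ℕ => Real.exp (-l) * l ^ n / n.factorial * Real.exp (-θ * n))
      (Real.exp (l * (Real.exp (-θ) - 1))) := by
    have h := (NormedSpace.expSeries_div_hasSum_exp ((l : ℝ) * Real.exp (-θ))).mul_left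
      (Real.exp (-l))
    rw [← Real.exp_eq_exp_ℝ, ← Real.exp_add] at h
    convert! h using 1
    · ext n
      rw [mul_pow, ← Real.exp_nat_mul, mul_comm (-θ)]
      ring
    · congr 1; ring
  rw [poissonMeasure, lintegral_sum_measure]
  simp only [lintegral_smul_measure, lintegral_dirac, smul_eq_mul]
  rw [← hs.tsum_eq, ENNReal.ofReal_tsum_of_nonneg (fun n => by positivity) hs.summable]
  exact tsum_congr fun n => (ENNReal.ofReal_mul (by positivity)).symm

/-- The walk that starts at `D`, has the upward jumps `h` and the drift `-δ` in each step. -/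
noncomputable def walk (D δ : ℝ) (h : ℕ → ℕ) (n : ℕ) : ℝ :=
  D + ∑ i ∈ Finset.range n, (h i : ℝ) - n * δ

/-- The paths of increments whose walk stays above the level `b` up to the time `n`. -/
def stayAbove (D δ b : ℝ) (n : ℕ) : Set (ℕ → ℕ) := {h | ∀ j ≤ n, b < walk D δ h j}

@[fun_prop]
theorem measurable_walk (D δ : ℝ) (n : ℕ) : Measurable fun h => walk D δ h n := by
  unfold walk; fun_prop

theorem walk_zero (D δ : ℝ) (h : ℕ → ℕ) : walk D δ h 0 = D := by simp [walk]

theorem walk_succ (D δ : ℝ) (h : ℕ → ℕ) (n : ℕ) :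
    walk D δ h (n + 1) = walk D δ h n + h n - δ := by
  simp only [walk, Finset.sum_range_succ]; push_cast; ring

theorem walk_congr (D δ : ℝ) {h h' : ℕ → ℕ} {n : ℕ} (hh : ∀ i < n, h i = h' i) :
    walk D δ h n = walk D δ h' n := by
  unfold walk
  rw [Finset.sum_congr rfl fun i hi => by rw [hh i (Finset.mem_range.1 hi)]]

theorem measurableSet_stayAbove (D δ b : ℝ) (n : ℕ) : MeasurableSet (stayAbove D δ b n) := by
  have : stayAbove D δ b n = ⋂ j, ⋂ (_ : j ≤ n), {h | b < walk D δ h j} := by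
    ext h; simp [stayAbove]
  rw [this]
  exact MeasurableSet.iInter fun j => MeasurableSet.iInter fun _ =>
    measurableSet_lt measurable_const (measurable_walk D δ j)

theorem stayAbove_congr {D δ b : ℝ} {h h' : ℕ → ℕ} {n : ℕ} (hh : ∀ i < n, h i = h' i) :
    h ∈ stayAbove D δ b n ↔ h' ∈ stayAbove D δ b n :=
  forall₂_congr fun _ hj => by rw [walk_congr D δ fun i hi => hh i (hi.trans_le hj)]

theorem stayAbove_succ_subset (D δ b : ℝ) (n : ℕ) :
    stayAbove D δ b (n + 1) ⊆ stayAbove D δ b n := fun _ h j hj => h j (hj.trans n.le_succ)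

/-- `ζ` is a sequence of Poisson variables of mean `l`, each independent of its predecessors. -/
structure IsPoissonSequence {Ω : Type*} [MeasurableSpace Ω] (ζ : ℕ → Ω → ℕ) (l : ℝ≥0)
    (μ : Measure Ω) : Prop where
  measurable : ∀ n, Measurable (ζ n)
  indep : ∀ n, IndepFun (fun ω i => if i < n then ζ i ω else 0) (ζ n) μ
  law : ∀ n, HasLaw (ζ n) (poissonMeasure l) μ

namespace IsPoissonSequence

variable {Ω : Type*} [MeasurableSpace Ω] {ζ : ℕ → Ω → ℕ} {l : ℝ≥0} {μ : Measure Ω}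

theorem measurable_path (h : IsPoissonSequence ζ l μ) : Measurable fun ω i => ζ i ω :=
  measurable_pi_lambda _ h.measurable

/-- The event and the walk at time `n` depend only on the first `n` increments, so the next step
splits off as an independent factor. Padding the history with zeros keeps it a point of `ℕ → ℕ`, to
which `A` and `walk` apply directly. -/
theorem lintegral_step (h : IsPoissonSequence ζ l μ) (D δ θ : ℝ) (n : ℕ)
    {A : Set (ℕ → ℕ)} (hA : MeasurableSet A)
    (hAn : ∀ g g' : ℕ → ℕ, (∀ i < n, g i = g' i) → (g ∈ A ↔ g' ∈ A)) :
    ∫⁻ ω in (fun ω i => ζ i ω) ⁻¹' A,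
        ENNReal.ofReal (Real.exp (-θ * walk D δ (fun i => ζ i ω) (n + 1))) ∂μ
      = ENNReal.ofReal (Real.exp (θ * δ + l * (Real.exp (-θ) - 1))) *
        ∫⁻ ω in (fun ω i => ζ i ω) ⁻¹' A,
          ENNReal.ofReal (Real.exp (-θ * walk D δ (fun i => ζ i ω) n)) ∂μ := by
  classical
  set H : Ω → ℕ → ℕ := fun ω i => if i < n then ζ i ω else 0 with hH
  have hHeq : ∀ ω, ∀ i < n, ζ i ω = H ω i := fun ω i hi => by simp [hH, hi]
  have hHm : Measurable H := measurable_pi_lambda _ fun i => by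
    by_cases hi : i < n
    · simpa [hH, hi] using h.measurable i
    · simp [hH, hi]
  have hpre : MeasurableSet ((fun ω i => ζ i ω) ⁻¹' A) := h.measurable_path hA
  set f : (ℕ → ℕ) → ℝ≥0∞ :=
    A.indicator fun g => ENNReal.ofReal (Real.exp (-θ * walk D δ g n)) with hf
  have hfm : Measurable f := Measurable.indicator (by fun_prop) hA
  set g : ℕ → ℝ≥0∞ := fun k => ENNReal.ofReal (Real.exp (-θ * k)) with hg
  have hgm : Measurable g := Measurable.of_discrete
  have hfω : ∀ ω, ((fun ω i => ζ i ω) ⁻¹' A).indicator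
      (fun ω => ENNReal.ofReal (Real.exp (-θ * walk D δ (fun i => ζ i ω) n))) ω = f (H ω) := by
    intro ω
    have hm := hAn (fun i => ζ i ω) (H ω) (hHeq ω)
    by_cases hω : H ω ∈ A
    · rw [hf, indicator_of_mem hω, indicator_of_mem (mem_preimage.2 (hm.2 hω)),
        walk_congr D δ (hHeq ω)]
    · rw [hf, indicator_of_notMem hω,
        indicator_of_notMem fun hc => hω (hm.1 (mem_preimage.1 hc))]
  have hfω' : ∀ ω, ((fun ω i => ζ i ω) ⁻¹' A).indicator
      (fun ω => ENNReal.ofReal (Real.exp (-θ * walk D δ (fun i => ζ i ω) (n + 1)))) ω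
        = ENNReal.ofReal (Real.exp (θ * δ)) * ((f ∘ H) * (g ∘ ζ n)) ω := by
    intro ω
    rw [Pi.mul_apply, Function.comp_apply, Function.comp_apply, ← hfω ω]
    by_cases hω : ω ∈ (fun ω i => ζ i ω) ⁻¹' A
    · rw [indicator_of_mem hω, indicator_of_mem hω, hg, ← ENNReal.ofReal_mul (by positivity),
        ← ENNReal.ofReal_mul (by positivity), ← Real.exp_add, ← Real.exp_add, walk_succ]
      congr 2; ring
    · rw [indicator_of_notMem hω, indicator_of_notMem hω]; simp
  rw [← lintegral_indicator hpre, ← lintegral_indicator hpre, lintegral_congr hfω,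
    lintegral_congr hfω', lintegral_const_mul _ ((hfm.comp hHm).mul (hgm.comp (h.measurable n))),
    lintegral_mul_eq_lintegral_mul_lintegral_of_indepFun (hfm.comp hHm)
      (hgm.comp (h.measurable n)) ((h.indep n).comp hfm hgm)]
  have hgi : ∫⁻ ω, (g ∘ ζ n) ω ∂μ = ENNReal.ofReal (Real.exp (l * (Real.exp (-θ) - 1))) := by
    rw [← lintegral_exp_poissonMeasure, ← (h.law n).map_eq,
      lintegral_map hgm (h.measurable n)]
    rfl
  rw [hgi, Real.exp_add, ENNReal.ofReal_mul (by positivity)]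
  simp only [Function.comp_apply]
  ring

theorem lintegral_exp_walk [IsProbabilityMeasure μ] (h : IsPoissonSequence ζ l μ) (D δ θ : ℝ)
    (n : ℕ) :
    ∫⁻ ω, ENNReal.ofReal (Real.exp (-θ * walk D δ (fun i => ζ i ω) n)) ∂μ
      = ENNReal.ofReal (Real.exp (θ * δ + l * (Real.exp (-θ) - 1))) ^ n *
        ENNReal.ofReal (Real.exp (-θ * D)) := by
  induction n with
  | zero => simp [walk_zero]
  | succ n ih =>
    have := h.lintegral_step D δ θ n MeasurableSet.univ (by simp)
    simp only [preimage_univ, setLIntegral_univ] at this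
    rw [this, ih, pow_succ']
    ring

/-- The exponential martingale of a walk, stopped when the walk leaves `(b, ∞)`. -/
theorem lintegral_stayAbove_succ (h : IsPoissonSequence ζ l μ) {D δ b θ : ℝ}
    (hθ : θ * δ + l * (Real.exp (-θ) - 1) = 0) (n : ℕ) :
    ∫⁻ ω in (fun ω i => ζ i ω) ⁻¹' stayAbove D δ b (n + 1),
        ENNReal.ofReal (Real.exp (-θ * walk D δ (fun i => ζ i ω) (n + 1))) ∂μ
      + ∫⁻ ω in (fun ω i => ζ i ω) ⁻¹' (stayAbove D δ b n \ stayAbove D δ b (n + 1)),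
        ENNReal.ofReal (Real.exp (-θ * walk D δ (fun i => ζ i ω) (n + 1))) ∂μ
      = ∫⁻ ω in (fun ω i => ζ i ω) ⁻¹' stayAbove D δ b n,
          ENNReal.ofReal (Real.exp (-θ * walk D δ (fun i => ζ i ω) n)) ∂μ := by
  have h1 := h.lintegral_step D δ θ n (measurableSet_stayAbove D δ b n)
    (fun g g' hg => stayAbove_congr hg)
  rw [hθ, Real.exp_zero, ENNReal.ofReal_one, one_mul] at h1
  rw [← h1, ← lintegral_union
    (h.measurable_path ((measurableSet_stayAbove D δ b n).diff (measurableSet_stayAbove D δ b _)))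
    (disjoint_sdiff_right.preimage _), ← preimage_union,
    union_sdiff_cancel (stayAbove_succ_subset D δ b n)]

/-- Jumps only go up, so one step lowers the walk by at most `δ`; this bounds the overshoot. -/
theorem walk_mem_of_exit {D δ b : ℝ} {g : ℕ → ℕ} {n : ℕ}
    (hg : g ∈ stayAbove D δ b n \ stayAbove D δ b (n + 1)) :
    b - δ ≤ walk D δ g (n + 1) ∧ walk D δ g (n + 1) ≤ b := by
  obtain ⟨h1, h2⟩ := hg
  constructor
  · have := h1 n le_rfl
    rw [walk_succ]
    have : (0 : ℝ) ≤ g n := Nat.cast_nonneg _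
    linarith
  · by_contra! hc
    refine h2 fun j hj => ?_
    rcases hj.lt_or_eq with hj | rfl
    · exact h1 j (Nat.lt_succ_iff.1 hj)
    · exact hc

theorem measure_compl_stayAbove_succ [IsFiniteMeasure μ] (h : IsPoissonSequence ζ l μ)
    (D δ b : ℝ) (n : ℕ) :
    μ ((fun ω i => ζ i ω) ⁻¹' (stayAbove D δ b (n + 1))ᶜ)
      = μ ((fun ω i => ζ i ω) ⁻¹' (stayAbove D δ b n)ᶜ)
        + μ ((fun ω i => ζ i ω) ⁻¹' (stayAbove D δ b n \ stayAbove D δ b (n + 1))) := by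
  rw [← measure_union _ (h.measurable_path
    ((measurableSet_stayAbove D δ b n).diff (measurableSet_stayAbove D δ b _))), ← preimage_union]
  · congr 2
    have := stayAbove_succ_subset D δ b n
    grind
  · exact disjoint_left.2 fun ω hω hω' => hω hω'.1

/-- Upper bound for the probability that a walk falls to the level `b` by the time `n`. -/
theorem exp_mul_measure_le [IsProbabilityMeasure μ] (h : IsPoissonSequence ζ l μ)
    {D δ b θ : ℝ} (hθ0 : 0 ≤ θ) (hθ : θ * δ + l * (Real.exp (-θ) - 1) = 0) (n : ℕ) :
    ∫⁻ ω in (fun ω i => ζ i ω) ⁻¹' stayAbove D δ b n,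
        ENNReal.ofReal (Real.exp (-θ * walk D δ (fun i => ζ i ω) n)) ∂μ
      + ENNReal.ofReal (Real.exp (-θ * b)) * μ ((fun ω i => ζ i ω) ⁻¹' (stayAbove D δ b n)ᶜ)
      ≤ ENNReal.ofReal (Real.exp (-θ * D)) := by
  induction n with
  | zero =>
    simp only [walk_zero, lintegral_const, Measure.restrict_apply_univ]
    by_cases hb : b < D
    · have : stayAbove D δ b 0 = univ := by ext g; simp [stayAbove, walk_zero, hb]
      simp [this]
    · have : stayAbove D δ b 0 = ∅ := by ext g; simp [stayAbove, walk_zero, hb]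
      simp only [this, preimage_empty, measure_empty, mul_zero, compl_empty, preimage_univ,
        measure_univ, mul_one, zero_add]
      gcongr ENNReal.ofReal (Real.exp ?_)
      nlinarith
  | succ n ih =>
    refine le_trans ?_ ih
    -- Only the paths exiting in this step change their term, and there the walk is at most `b`.
    rw [← h.lintegral_stayAbove_succ hθ n, h.measure_compl_stayAbove_succ, mul_add,
      add_comm (_ * _) (_ * _), ← add_assoc]
    refine add_le_add_left (add_le_add_right ?_ _) _
    rw [← setLIntegral_const]
    refine setLIntegral_mono' (h.measurable_path
      ((measurableSet_stayAbove D δ b n).diff (measurableSet_stayAbove D δ b _))) fun ω hω => ?_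
    have := (walk_mem_of_exit hω).2
    gcongr ENNReal.ofReal (Real.exp ?_)
    nlinarith

/-- Lower bound for the probability that a walk falls to the level `0` by the time `n`. -/
theorem le_exp_mul_measure [IsProbabilityMeasure μ] (h : IsPoissonSequence ζ l μ)
    {D δ θ : ℝ} (hD : 0 ≤ D) (hδ : 0 ≤ δ) (hθ0 : 0 ≤ θ)
    (hθ : θ * δ + l * (Real.exp (-θ) - 1) = 0) (n : ℕ) :
    ENNReal.ofReal (Real.exp (-θ * D)) ≤
    ∫⁻ ω in (fun ω i => ζ i ω) ⁻¹' stayAbove D δ 0 n,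
        ENNReal.ofReal (Real.exp (-θ * walk D δ (fun i => ζ i ω) n)) ∂μ
      + ENNReal.ofReal (Real.exp (θ * δ)) * μ ((fun ω i => ζ i ω) ⁻¹' (stayAbove D δ 0 n)ᶜ) := by
  induction n with
  | zero =>
    simp only [walk_zero, lintegral_const, Measure.restrict_apply_univ]
    by_cases hb : 0 < D
    · have : stayAbove D δ 0 0 = univ := by ext g; simp [stayAbove, walk_zero, hb]
      simp [this]
    · have : stayAbove D δ 0 0 = ∅ := by ext g; simp [stayAbove, walk_zero, hb]
      simp only [this, preimage_empty, measure_empty, mul_zero, compl_empty, preimage_univ,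
        measure_univ, mul_one, zero_add]
      gcongr ENNReal.ofReal (Real.exp ?_)
      nlinarith [mul_nonneg hθ0 hδ, mul_nonneg hθ0 hD]
  | succ n ih =>
    refine ih.trans ?_
    -- On the newly exiting paths the walk is at least `-δ`, whence the factor `exp (θ δ)`.
    rw [← h.lintegral_stayAbove_succ hθ n, h.measure_compl_stayAbove_succ, mul_add,
      add_comm (_ * _) (_ * _), ← add_assoc]
    refine add_le_add_left (add_le_add_right ?_ _) _
    rw [← setLIntegral_const]
    refine setLIntegral_mono' (h.measurable_path
      ((measurableSet_stayAbove D δ 0 n).diff (measurableSet_stayAbove D δ 0 _))) fun ω hω => ?_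
    have := (walk_mem_of_exit hω).1
    gcongr ENNReal.ofReal (Real.exp ?_)
    nlinarith

theorem measure_exists_walk_le [IsProbabilityMeasure μ] (h : IsPoissonSequence ζ l μ)
    {D δ b θ : ℝ} (hθ0 : 0 ≤ θ) (hθ : θ * δ + l * (Real.exp (-θ) - 1) = 0) :
    μ {ω | ∃ j, walk D δ (fun i => ζ i ω) j ≤ b} ≤ ENNReal.ofReal (Real.exp (-θ * (D - b))) := by
  have hU : {ω | ∃ j, walk D δ (fun i => ζ i ω) j ≤ b}
      ⊆ ⋃ n, (fun ω i => ζ i ω) ⁻¹' (stayAbove D δ b n)ᶜ := by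
    rintro ω ⟨j, hj⟩
    exact mem_iUnion.2 ⟨j, fun hc => (hc j le_rfl).not_ge hj⟩
  have hmono : Monotone fun n => (fun ω i => ζ i ω) ⁻¹' (stayAbove D δ b n)ᶜ :=
    monotone_nat_of_le_succ fun n =>
      preimage_mono (compl_subset_compl.2 (stayAbove_succ_subset D δ b n))
  refine (measure_mono hU).trans ?_
  rw [hmono.measure_iUnion]
  refine iSup_le fun n => ?_
  have h1 := le_add_self.trans (h.exp_mul_measure_le (D := D) (b := b) hθ0 hθ n)
  have h2 : ENNReal.ofReal (Real.exp (-θ * (D - b)))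
      = ENNReal.ofReal (Real.exp (θ * b)) * ENNReal.ofReal (Real.exp (-θ * D)) := by
    rw [← ENNReal.ofReal_mul (by positivity), ← Real.exp_add]; congr 2; ring
  have h3 : ENNReal.ofReal (Real.exp (θ * b)) * ENNReal.ofReal (Real.exp (-θ * b)) = 1 := by
    rw [← ENNReal.ofReal_mul (by positivity), ← Real.exp_add]; simp
  rw [h2]
  refine le_trans (le_of_eq ?_) (mul_le_mul_right h1 (ENNReal.ofReal (Real.exp (θ * b))))
  rw [← mul_assoc, h3, one_mul]

/-- The surviving part of the stopped martingale must vanish in the limit. While the walk is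
positive, `exp (-θ * walk) ≤ exp (-(θ / 2) * walk)`, and the mean of the latter is a constant times
`q ^ n` with `q < 1` by `hθ2`. -/
theorem le_measure_exists_walk [IsProbabilityMeasure μ] (h : IsPoissonSequence ζ l μ)
    {D δ θ : ℝ} (hD : 0 ≤ D) (hδ : 0 ≤ δ) (hθ0 : 0 ≤ θ)
    (hθ : θ * δ + l * (Real.exp (-θ) - 1) = 0)
    (hθ2 : θ / 2 * δ + l * (Real.exp (-(θ / 2)) - 1) < 0) :
    ENNReal.ofReal (Real.exp (-θ * (D + δ))) ≤ μ {ω | ∃ j, walk D δ (fun i => ζ i ω) j ≤ 0} := by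
  set M := μ {ω | ∃ j, walk D δ (fun i => ζ i ω) j ≤ 0}
  set q := ENNReal.ofReal (Real.exp (θ / 2 * δ + l * (Real.exp (-(θ / 2)) - 1))) with hq
  have hq1 : q < 1 := by
    rw [hq, ← ENNReal.ofReal_one]
    exact (ENNReal.ofReal_lt_ofReal_iff one_pos).2 (Real.exp_lt_one_iff.2 hθ2)
  have hbound : ∀ n, ENNReal.ofReal (Real.exp (-θ * D))
      ≤ q ^ n * ENNReal.ofReal (Real.exp (-(θ / 2) * D))
        + ENNReal.ofReal (Real.exp (θ * δ)) * M := by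
    intro n
    refine (h.le_exp_mul_measure hD hδ hθ0 hθ n).trans (add_le_add ?_ ?_)
    · rw [hq, ← h.lintegral_exp_walk D δ (θ / 2) n]
      refine le_trans (setLIntegral_mono'
        (h.measurable_path (measurableSet_stayAbove D δ 0 n)) fun ω hω => ?_)
        (setLIntegral_le_lintegral _ _)
      have : 0 < walk D δ (fun i => ζ i ω) n := hω n le_rfl
      gcongr ENNReal.ofReal (Real.exp ?_)
      nlinarith
    · refine mul_le_mul_right (measure_mono fun ω hω => ?_) _
      by_contra hc
      exact hω fun j _ => not_le.1 fun hj => hc ⟨j, hj⟩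
  have hlim : Tendsto (fun n => q ^ n * ENNReal.ofReal (Real.exp (-(θ / 2) * D))
      + ENNReal.ofReal (Real.exp (θ * δ)) * M) atTop
      (𝓝 (0 * ENNReal.ofReal (Real.exp (-(θ / 2) * D)) + ENNReal.ofReal (Real.exp (θ * δ)) * M)) :=
    (ENNReal.Tendsto.mul_const (ENNReal.tendsto_pow_atTop_nhds_zero_of_lt_one hq1)
      (Or.inr ENNReal.ofReal_ne_top)).add_const _
  have h1 := ge_of_tendsto' hlim hbound
  rw [zero_mul, zero_add] at h1
  have h2 : ENNReal.ofReal (Real.exp (-θ * (D + δ)))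
      = ENNReal.ofReal (Real.exp (-θ * δ)) * ENNReal.ofReal (Real.exp (-θ * D)) := by
    rw [← ENNReal.ofReal_mul (by positivity), ← Real.exp_add]; congr 2; ring
  have h3 : ENNReal.ofReal (Real.exp (-θ * δ)) * ENNReal.ofReal (Real.exp (θ * δ)) = 1 := by
    rw [← ENNReal.ofReal_mul (by positivity), ← Real.exp_add]; simp
  rw [h2]
  refine (mul_le_mul_right h1 _).trans (le_of_eq ?_)
  rw [← mul_assoc, h3, one_mul]

end IsPoissonSequence

/-! ### Poisson processes on a grid -/

/-- The increments of a counting path over the intervals `(i δ, (i + 1) δ]`. -/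
def gridIncrements (δ : ℝ≥0) (n : ℝ≥0 → ℕ) (i : ℕ) : ℕ := n ((i + 1 : ℕ) * δ) - n (i * δ)

theorem measurable_gridIncrements_path (δ : ℝ≥0) : Measurable (gridIncrements δ) :=
  measurable_pi_lambda _ fun _ => by
    unfold gridIncrements
    exact (measurable_pi_apply _).sub (measurable_pi_apply _)

theorem sum_gridIncrements {n : ℝ≥0 → ℕ} (hn : Monotone n) (h0 : n 0 = 0) (δ : ℝ≥0) (k : ℕ) :
    ∑ i ∈ Finset.range k, gridIncrements δ n i = n (k * δ) := by
  unfold gridIncrements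
  rw [Finset.sum_range_tsub (f := fun i : ℕ => n (i * δ)) fun a b hab => hn (by gcongr)]
  simp [h0]

theorem indepFun_history {Ω β : Type*} [MeasurableSpace Ω] [MeasurableSpace β] {μ : Measure Ω}
    {X : ℕ → Ω → β} (hX : ∀ i, Measurable (X i)) (h : iIndepFun X μ) (n : ℕ) {f : β → ℕ}
    (hf : Measurable f) :
    IndepFun (fun ω i => if i < n then f (X i ω) else 0) (fun ω => f (X n ω)) μ := by
  have h1 := h.indepFun_finset (Finset.range n) {n} (by simp) hX
  refine h1.comp (φ := fun g i => if hi : i < n then f (g ⟨i, Finset.mem_range.2 hi⟩) else 0)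
    (ψ := fun g => f (g ⟨n, Finset.mem_singleton_self n⟩)) ?_ (by fun_prop)
  refine measurable_pi_lambda _ fun i => ?_
  by_cases hi : i < n
  · simp only [hi, dite_true]; fun_prop
  · simp [hi]

variable {Ω : Type*} [MeasurableSpace Ω] {μ : Measure Ω}

theorem IsPoissonProcess.iIndepFun_gridIncrements {N : ℝ≥0 → Ω → ℕ} {r : ℝ≥0}
    (hN : IsPoissonProcess N r μ) (δ : ℝ≥0) :
    iIndepFun (fun i ω => gridIncrements δ (fun t => N t ω) i) μ :=
  hN.indep.nat (t := fun i : ℕ => (i : ℝ≥0) * δ) fun a b hab => by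
    dsimp only; gcongr

theorem IsPoissonProcess.measurable_gridIncrements {N : ℝ≥0 → Ω → ℕ} {r : ℝ≥0}
    (hN : IsPoissonProcess N r μ) (δ : ℝ≥0) (i : ℕ) :
    Measurable fun ω => gridIncrements δ (fun t => N t ω) i :=
  (hN.measurable _).sub (hN.measurable _)

theorem IsPoissonProcess.hasLaw_gridIncrements {N : ℝ≥0 → Ω → ℕ} {r : ℝ≥0}
    (hN : IsPoissonProcess N r μ) (δ : ℝ≥0) (i : ℕ) :
    HasLaw (fun ω => gridIncrements δ (fun t => N t ω) i) (poissonMeasure (r * δ)) μ := by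
  have h := hN.law ((i : ℝ≥0) * δ) ((i + 1 : ℕ) * δ) (by gcongr; simp)
  have hδ : ((i + 1 : ℕ) : ℝ≥0) * δ - i * δ = δ := by
    push_cast; rw [add_mul, one_mul, add_tsub_cancel_left]
  rwa [hδ] at h

theorem IsPoissonProcess.isPoissonSequence {N : ℝ≥0 → Ω → ℕ} {r : ℝ≥0}
    (hN : IsPoissonProcess N r μ) (δ : ℝ≥0) :
    IsPoissonSequence (fun i ω => gridIncrements δ (fun t => N t ω) i) (r * δ) μ where
  measurable := hN.measurable_gridIncrements δ
  indep n := indepFun_history (hN.measurable_gridIncrements δ) (hN.iIndepFun_gridIncrements δ) n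
    measurable_id
  law := hN.hasLaw_gridIncrements δ

theorem iIndepFun_bool {β : Bool → Type*} [∀ b, MeasurableSpace (β b)] [IsProbabilityMeasure μ]
    {X : ∀ b, Ω → β b} (h : IndepFun (X false) (X true) μ) : iIndepFun X μ := by
  rw [iIndepFun_iff_measure_inter_preimage_eq_mul]
  intro S sets hS
  have key := h.measure_inter_preimage_eq_mul (sets false) (sets true)
  by_cases h0 : false ∈ S <;> by_cases h1 : true ∈ S
  · have hS' : S = {false, true} := by ext b; cases b <;> simp [h0, h1]
    have hI : ⋂ i, X i ⁻¹' sets i = X false ⁻¹' sets false ∩ X true ⁻¹' sets true := by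
      ext ω; simp
    subst hS'
    simpa [hI] using key (hS _ h0) (hS _ h1)
  · have hS' : S = {false} := by ext b; cases b <;> simp [h0, h1]
    subst hS'; simp
  · have hS' : S = {true} := by ext b; cases b <;> simp [h0, h1]
    subst hS'; simp
  · have hS' : S = ∅ := by ext b; cases b <;> simp [h0, h1]
    subst hS'; simp

theorem IsPoissonProcess.isPoissonSequence_add [IsProbabilityMeasure μ] {N N' : ℝ≥0 → Ω → ℕ}
    {r r' : ℝ≥0} (hN : IsPoissonProcess N r μ) (hN' : IsPoissonProcess N' r' μ)
    (hind : IndepFun (fun ω t => N t ω) (fun ω t => N' t ω) μ) (δ : ℝ≥0) :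
    IsPoissonSequence (fun i ω => gridIncrements δ (fun t => N t ω) i +
      gridIncrements δ (fun t => N' t ω) i) ((r + r') * δ) μ := by
  set X : Bool → ℕ → Ω → ℕ := fun b i ω =>
    gridIncrements δ (fun t => (bif b then N' else N) t ω) i with hX
  have hXm : ∀ b i, Measurable (X b i) := fun b i => by
    cases b
    · exact hN.measurable_gridIncrements δ i
    · exact hN'.measurable_gridIncrements δ i
  have hrows : IndepFun (fun ω i => X false i ω) (fun ω i => X true i ω) μ :=
    hind.comp (measurable_gridIncrements_path δ) (measurable_gridIncrements_path δ)
  -- Independence between the two processes and within each one combine into a single independent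
  -- family, from which disjoint blocks of indices can be taken.
  have hall : iIndepFun (fun (p : Bool × ℕ) ω => X p.1 p.2 ω) μ :=
    iIndepFun_uncurry' hXm (iIndepFun_bool hrows) fun b => by
      cases b
      · exact hN.iIndepFun_gridIncrements δ
      · exact hN'.iIndepFun_gridIncrements δ
  refine ⟨fun i => (hXm false i).add (hXm true i), fun n => ?_, fun n => ?_⟩
  · have h1 := hall.indepFun_finset (Finset.univ ×ˢ Finset.range n) (Finset.univ ×ˢ {n})
      (by rw [Finset.disjoint_left]; simp; omega) (fun p => hXm p.1 p.2)
    refine h1.comp (φ := fun g i => if hi : i < n then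
        g ⟨(false, i), by simp [hi]⟩ + g ⟨(true, i), by simp [hi]⟩ else 0)
      (ψ := fun g => g ⟨(false, n), by simp⟩ + g ⟨(true, n), by simp⟩) ?_ (by fun_prop)
    refine measurable_pi_lambda _ fun i => ?_
    by_cases hi : i < n
    · simp only [hi, dite_true]; fun_prop
    · simp only [hi, dite_false]; exact measurable_const
  · rw [add_mul]
    exact IndepFun.hasLaw_add_poissonMeasure
      (hrows.comp (measurable_pi_apply n) (measurable_pi_apply n))
      (hN.hasLaw_gridIncrements δ n) (hN'.hasLaw_gridIncrements δ n)

/-! ### Buffer paths -/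

/-- Induction on the largest point `a`: the other points lie below some `b < a`, and `c b` is at
most the left limit at `a`, so the jumps do not overlap. -/
theorem sum_jumps_le {c : ℝ≥0 → ℕ} (hc : Monotone c) (S : Finset ℝ≥0) :
    (∀ s ∈ S, 0 < s) → ∀ t, (∀ s ∈ S, s ≤ t) →
    ∑ s ∈ S, ((c s : ℝ) - Function.leftLim (fun r => (c r : ℝ)) s) ≤ (c t : ℝ) - c 0 := by
  have hc' : Monotone fun r => (c r : ℝ) := Nat.mono_cast.comp hc
  induction S using Finset.induction_on_max with
  | empty => intro _ t _; simpa using hc (zero_le (a := t))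
  | insert a S ha ih =>
    intro hpos t ht
    have ha0 : 0 < a := hpos a (by simp)
    rw [Finset.sum_insert fun h => (ha a h).false]
    obtain ⟨b, hba, hb⟩ : ∃ b < a, ∀ s ∈ S, s ≤ b := by
      rcases S.eq_empty_or_nonempty with rfl | hS
      · exact ⟨0, ha0, by simp⟩
      · exact ⟨S.max' hS, ha _ (S.max'_mem hS), fun s hs => S.le_max' s hs⟩
    have h1 := ih (fun s hs => hpos s (by simp [hs])) b hb
    have h2 : (c b : ℝ) ≤ Function.leftLim (fun r => (c r : ℝ)) a := hc'.le_leftLim hba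
    have h3 : (c a : ℝ) ≤ c t := hc' (ht a (by simp))
    linarith

theorem costlyArrivals_le {c : ℝ≥0 → ℕ} (hc : Monotone c) (u : ℝ≥0 → Bool) (t : ℝ≥0) :
    costlyArrivals c u t ≤ c t := by
  have hc' : Monotone fun r => (c r : ℝ) := Nat.mono_cast.comp hc
  unfold costlyArrivals
  rw [finsum_mem_def]
  set f : ℝ≥0 → ℝ := (Ioc (0 : ℝ≥0) t).indicator fun s =>
    if u s = true then (c s : ℝ) - Function.leftLim (fun r => (c r : ℝ)) s else 0 with hf
  by_cases hfin : (Function.support f).Finite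
  · rw [finsum_eq_sum f hfin]
    have hmem : ∀ s ∈ hfin.toFinset, s ∈ Ioc (0 : ℝ≥0) t := fun s hs => by
      by_contra hc
      exact (hfin.mem_toFinset.1 hs) (indicator_of_notMem hc _)
    have h1 := sum_jumps_le hc hfin.toFinset (fun s hs => (hmem s hs).1) t
      fun s hs => (hmem s hs).2
    have h2 : ∑ s ∈ hfin.toFinset, f s ≤
        ∑ s ∈ hfin.toFinset, ((c s : ℝ) - Function.leftLim (fun r => (c r : ℝ)) s) := by
      refine Finset.sum_le_sum fun s hs => ?_
      rw [hf, indicator_of_mem (hmem s hs)]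
      have h3 : Function.leftLim (fun r => (c r : ℝ)) s ≤ (c s : ℝ) := hc'.leftLim_le le_rfl
      split_ifs <;> linarith
    have h4 : (0 : ℝ) ≤ c 0 := Nat.cast_nonneg _
    linarith
  -- A `finsum` with infinite support is `0` by convention, and the bound is then trivial.
  · rw [finsum_of_infinite_support hfin]
    positivity

theorem walk_gridIncrements {n : ℝ≥0 → ℕ} (hn : Monotone n) (h0 : n 0 = 0) (D : ℝ) (δ : ℝ≥0)
    (k : ℕ) : walk D δ (gridIncrements δ n) k = D + n (k * δ) - k * δ := by
  rw [walk, ← sum_gridIncrements hn h0]; push_cast; ring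

/-- At the last grid point up to `t` there are no more arrivals than at `t`, and less than `δ` of
playback is missing. -/
theorem exists_walk_le_of_buffer_le {n : ℝ≥0 → ℕ} (hn : Monotone n) (h0 : n 0 = 0) {D : ℝ}
    {δ t : ℝ≥0} (hδ : 0 < δ) (ht : D + n t - t ≤ 0) :
    ∃ k, walk D δ (gridIncrements δ n) k ≤ δ := by
  refine ⟨⌊t / δ⌋₊, ?_⟩
  have h1 : (⌊t / δ⌋₊ : ℝ≥0) * δ ≤ t :=
    (le_div_iff₀ hδ).1 (Nat.floor_le zero_le)
  have h2 : t < ((⌊t / δ⌋₊ : ℝ≥0) + 1) * δ := (div_lt_iff₀ hδ).1 (Nat.lt_floor_add_one _)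
  have h2' : (t : ℝ) < ((⌊t / δ⌋₊ : ℝ) + 1) * δ := by exact_mod_cast h2
  have h3 : (n (⌊t / δ⌋₊ * δ) : ℝ) ≤ n t := by exact_mod_cast hn h1
  rw [walk_gridIncrements hn h0]
  linarith

theorem finishTime_top (x : ℝ≥0 → ℝ) : finishTime ∞ x = ∞ := by
  simp [finishTime]

theorem exists_le_of_emptyTime_lt {x : ℝ≥0 → ℝ} {s : ℝ≥0∞} (h : emptyTime x < s) :
    ∃ t, x t ≤ 0 := by
  obtain ⟨t, ht⟩ := iInf_lt_iff.1 h
  obtain ⟨ht', -⟩ := iInf_lt_iff.1 ht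
  exact ⟨t, ht'⟩

theorem emptyTime_lt_top {x : ℝ≥0 → ℝ} {t : ℝ≥0} (h : x t ≤ 0) : emptyTime x < ∞ :=
  (iInf₂_le t h).trans_lt ENNReal.coe_lt_top

theorem costlyArrivals_false (c : ℝ≥0 → ℕ) (t : ℝ≥0) :
    costlyArrivals c (fun _ => false) t = 0 := by
  simp [costlyArrivals]

/-- The control policy that only uses the free server. -/
def freePolicy (N Nc : ℝ≥0 → Ω → ℕ) (μ : Measure Ω) (D : ℝ) (hN : ∀ t, Measurable (N t)) :
    ControlPolicy N Nc μ D where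
  rule := freeOnly
  x t ω := D + N t ω - t
  u _ _ := false
  measurable_x t := by
    have := hN t
    fun_prop
  measurable_u := measurable_const
  trajectory := .of_forall fun ω => ⟨fun t => by simp [costlyArrivals_false], fun _ => rfl⟩
  unique := .of_forall fun ω x' u' h => by
    have hu : u' = fun _ => false := funext h.action
    refine ⟨funext fun t => ?_, hu⟩
    rw [h.buffer t, hu, costlyArrivals_false, add_zero]

theorem freePolicy_feasible [IsProbabilityMeasure μ] {N Nc : ℝ≥0 → Ω → ℕ} {R : ℝ≥0} {D ε : ℝ}
    (hN : IsPoissonProcess N R μ) (hR : 1 < R) (hε : 0 < ε)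
    (hDε : D ≥ 1 / rBar (R : ℝ) * Real.log (1 / ε)) (F : ℝ≥0∞) :
    (freePolicy N Nc μ D hN.measurable).Feasible F ε := by
  obtain ⟨hr, hroot⟩ := rBar_spec (R := (R : ℝ)) (by exact_mod_cast hR)
  set r := rBar (R : ℝ)
  have hbound : ∀ δ : ℝ≥0, 0 < δ → (freePolicy N Nc μ D hN.measurable).interruptionProb F
      ≤ ENNReal.ofReal (Real.exp (-r * (D - δ))) := by
    intro δ hδ
    -- The root equation scales with the mesh, so the same exponent `r` serves every `δ`.
    have hθ : r * δ + ((R * δ : ℝ≥0) : ℝ) * (Real.exp (-r) - 1) = 0 := by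
      push_cast
      linear_combination (δ : ℝ) * hroot
    refine le_trans (measure_mono_ae ?_)
      ((hN.isPoissonSequence δ).measure_exists_walk_le (D := D) (b := δ) hr.le hθ)
    filter_upwards [hN.start, hN.mono] with ω h0 hm hω
    obtain ⟨t, ht⟩ := exists_le_of_emptyTime_lt hω
    exact exists_walk_le_of_buffer_le hm h0 hδ ht
  have hlim : Tendsto (fun δ : ℝ≥0 => ENNReal.ofReal (Real.exp (-r * (D - δ)))) (𝓝[>] 0)
      (𝓝 (ENNReal.ofReal (Real.exp (-r * (D - (0 : ℝ≥0)))))) :=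
    (ENNReal.continuous_ofReal.comp (by fun_prop)).continuousWithinAt
  refine (ge_of_tendsto hlim (eventually_mem_nhdsWithin.mono hbound)).trans
    (ENNReal.ofReal_le_ofReal ?_)
  rw [← Real.le_log_iff_exp_le hε]
  have h1 : r * (1 / r * Real.log (1 / ε)) ≤ r * D := by gcongr
  rw [one_div, one_div, Real.log_inv, mul_inv_cancel_left₀ hr.ne'] at h1
  push_cast
  linarith

theorem ControlPolicy.not_feasible_top [IsProbabilityMeasure μ] {N Nc : ℝ≥0 → Ω → ℕ}
    {R₀ Rc : ℝ≥0} {D ε : ℝ} (hN : IsPoissonProcess N R₀ μ) (hNc : IsPoissonProcess Nc Rc μ)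
    (hindep : IndepFun (fun ω t => N t ω) (fun ω t => Nc t ω) μ)
    (hD : 0 ≤ D) (hε : 0 < ε) (hR : 1 < R₀ + Rc)
    (hDε : D < 1 / rBar ((R₀ + Rc : ℝ≥0) : ℝ) * Real.log (1 / ε)) (P : ControlPolicy N Nc μ D) :
    ¬ P.Feasible ∞ ε := by
  have hR' : (1 : ℝ) < ((R₀ + Rc : ℝ≥0) : ℝ) := by exact_mod_cast hR
  obtain ⟨hr, hroot⟩ := rBar_spec hR'
  set r := rBar ((R₀ + Rc : ℝ≥0) : ℝ)
  have hhalf := half_root_neg (by linarith) hr hroot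
  -- Half of the strict gap in `hDε` serves as mesh and absorbs the overshoot.
  obtain ⟨δ', hδ', hDδ⟩ : ∃ δ' : ℝ, 0 < δ' ∧ D + δ' < 1 / r * Real.log (1 / ε) :=
    ⟨(1 / r * Real.log (1 / ε) - D) / 2, by linarith, by linarith⟩
  lift δ' to ℝ≥0 using hδ'.le with δ
  have hθ : r * δ + (((R₀ + Rc) * δ : ℝ≥0) : ℝ) * (Real.exp (-r) - 1) = 0 := by
    rw [NNReal.coe_mul]
    linear_combination (δ : ℝ) * hroot
  have hθ2 : r / 2 * δ + (((R₀ + Rc) * δ : ℝ≥0) : ℝ) * (Real.exp (-(r / 2)) - 1) < 0 := by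
    rw [NNReal.coe_mul]
    have := mul_neg_of_neg_of_pos hhalf hδ'
    linarith
  have hlow := (hN.isPoissonSequence_add hNc hindep δ).le_measure_exists_walk hD hδ'.le hr.le
    hθ hθ2
  have hle : μ {ω | ∃ j, walk D δ (fun i => gridIncrements δ (fun t => N t ω) i +
      gridIncrements δ (fun t => Nc t ω) i) j ≤ 0} ≤ P.interruptionProb ∞ := by
    refine measure_mono_ae ?_
    filter_upwards [hN.start, hN.mono, hNc.start, hNc.mono, P.trajectory]
      with ω h0 hm h0c hmc htr hω
    obtain ⟨j, hj⟩ := hω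
    change emptyTime _ < finishTime ∞ _
    rw [finishTime_top]
    refine emptyTime_lt_top (t := j * δ) ?_
    -- Whatever the actions, the buffer at a grid time is at most the walk driven by both servers.
    have hcost := costlyArrivals_le hmc (fun t => P.u t ω) (j * δ)
    have hw := walk_gridIncrements hm h0 D δ j
    have hc := sum_gridIncrements hmc h0c δ j
    rw [← hc] at hcost
    rw [htr.buffer]
    simp only [walk] at hj hw
    push_cast [Finset.sum_add_distrib] at hj hcost ⊢
    linarith
  have hlt : ENNReal.ofReal ε < ENNReal.ofReal (Real.exp (-r * (D + δ))) := by
    rw [ENNReal.ofReal_lt_ofReal_iff (Real.exp_pos _), ← Real.log_lt_iff_lt_exp hε]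
    have h1 : r * (D + δ) < r * (1 / r * Real.log (1 / ε)) := by gcongr
    rw [one_div, one_div, Real.log_inv, mul_inv_cancel_left₀ hr.ne'] at h1
    linarith
  exact not_le.2 (hlt.trans_le (hlow.trans hle))

end MediaStreaming

theorem mainTheorem7 {Ω : Type*} [MeasurableSpace Ω] (μ : Measure Ω) [IsProbabilityMeasure μ]
    (R₀ Rc : ℝ≥0) (hR₀ : 0 < R₀) (hRc : 0 < Rc)
    (N Nc : ℝ≥0 → Ω → ℕ)
    (hN : MediaStreaming.IsPoissonProcess N R₀ μ)
    (hNc : MediaStreaming.IsPoissonProcess Nc Rc μ)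
    (hindep : IndepFun (fun ω t => N t ω) (fun ω t => Nc t ω) μ)
    (D ε : ℝ) (hD : 0 ≤ D) (hε : 0 < ε) :
    (1 < R₀ → D ≥ 1 / MediaStreaming.rBar (R₀ : ℝ) * Real.log (1 / ε) → ∀ F : ℝ≥0∞,
      IsLeast (Set.range fun P : MediaStreaming.ControlPolicy N Nc μ D => P.cost F ε) 0 ∧
      ∃ P : MediaStreaming.ControlPolicy N Nc μ D,
        P.rule = MediaStreaming.freeOnly ∧ P.Feasible F ε ∧ P.cost F ε = 0) ∧
    (1 < R₀ + Rc →
      D < 1 / MediaStreaming.rBar ((R₀ + Rc : ℝ≥0) : ℝ) * Real.log (1 / ε) →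
      IsLeast (Set.range fun P : MediaStreaming.ControlPolicy N Nc μ D => P.cost ∞ ε) ∞ ∧
      ∀ P : MediaStreaming.ControlPolicy N Nc μ D, ¬ P.Feasible ∞ ε) := by

  refine ⟨fun hR hDε F => ?_, fun hR hDε => ?_⟩
  · set P := MediaStreaming.freePolicy N Nc μ D hN.measurable
    have hfeas : P.Feasible F ε := MediaStreaming.freePolicy_feasible hN hR hε hDε F
    have hcost : P.cost F ε = 0 := by
      rw [MediaStreaming.ControlPolicy.cost, if_pos hfeas]
      simp [P, MediaStreaming.freePolicy]
    exact ⟨⟨⟨P, hcost⟩, fun _ _ => zero_le⟩, P, rfl, hfeas, hcost⟩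
  · have hnot := MediaStreaming.ControlPolicy.not_feasible_top hN hNc hindep hD hε hR hDε
    have hcost : ∀ P : MediaStreaming.ControlPolicy N Nc μ D, P.cost ∞ ε = ∞ :=
      fun P => if_neg (hnot P)
    refine ⟨⟨⟨MediaStreaming.freePolicy N Nc μ D hN.measurable, hcost _⟩, ?_⟩, hnot⟩
    rintro _ ⟨P, rfl⟩
    exact (hcost P).ge
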